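/- Let $E$ be a topological space that is $\pi$-finite: all its homotopy groups $\pi_k(E,x)$ ($k\ge 1$, $x\in E$) are finite, they vanish for all $k$ above some bound that does not depend on $x$, and the set $\pi_0 E$ of path components is finite. Let $\Omega_xE$ be the based loop space at $x$, and let the free loop space $\Lambda E$ be the homotopy pullback of the diagonal $E\to E\times E$ along itself. Homotopy cardinality $|X|\in\mathbb{Q}$ of $\pi$-finite spaces $X$ is defined by the recursion $$|X|=\sum_{x\in\pi_0X}\frac{1}{|\Omega_xX|}$$ (one base point $x$ in each path component), with $|X|=1$ for weakly contractible $X$. Then $\Lambda E$ and all the $\Omega_xE$ are $\pi$-finite, and $$|\Lambda E|=\sum_{x\in\pi_0E}\frac{|\Omega_xE|}{|\Omega_xE|}=|\pi_0E|,$$ where $|\pi_0E|$ is the number of path components of $E$. -/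

import Mathlib

open scoped Topology unitInterval

noncomputable section

universe u v w

/-- The homotopy pullback of `f : X → Z` and `g : Y → Z`: the space of triples `(x, y, γ)` where
`γ` is a path in `Z` from `f x` to `g y` (compact-open topology on the paths). -/
def HomotopyPullback {X : Type u} {Y : Type v} {Z : Type w} [TopologicalSpace X]
    [TopologicalSpace Y] [TopologicalSpace Z] (f : C(X, Z)) (g : C(Y, Z)) : Type (max u v w) :=
  {t : X × Y × C(I, Z) // t.2.2 0 = f t.1 ∧ t.2.2 1 = g t.2.1}

instance HomotopyPullback.instTopologicalSpace {X : Type u} {Y : Type v} {Z : Type w}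
    [TopologicalSpace X] [TopologicalSpace Y] [TopologicalSpace Z] (f : C(X, Z)) (g : C(Y, Z)) :
    TopologicalSpace (HomotopyPullback f g) :=
  inferInstanceAs (TopologicalSpace {t : X × Y × C(I, Z) // t.2.2 0 = f t.1 ∧ t.2.2 1 = g t.2.1})

/-- The diagonal map `X → X × X`. -/
def diagonalMap (X : Type u) [TopologicalSpace X] : C(X, X × X) :=
  (ContinuousMap.id X).prodMk (ContinuousMap.id X)

/-- The free loop space `ΛX`: the homotopy pullback of the diagonal of `X` along itself.
A point consists of two points of `X` and two paths from the first to the second. -/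
abbrev FreeLoopSpace (X : Type u) [TopologicalSpace X] : Type u :=
  HomotopyPullback (diagonalMap X) (diagonalMap X)

/-- `X` is `n`-truncated: its homotopy groups in degrees above `n` vanish, at all base points. -/
def IsTruncatedSpace (n : ℕ) (X : Type u) [TopologicalSpace X] : Prop :=
  ∀ k : ℕ, n < k → ∀ x : X, Subsingleton (π_ k X x)

/-- A space is `π`-finite if it is truncated, has finitely many path components, and all its
homotopy groups, at all base points, are finite. -/
structure IsPiFinite (X : Type u) [TopologicalSpace X] : Prop where
  truncated : ∃ n : ℕ, IsTruncatedSpace n X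
  finite_components : Finite (ZerothHomotopy X)
  finite_homotopyGroups : ∀ k : ℕ, 1 ≤ k → ∀ x : X, Finite (π_ k X x)

/-- The recursion `|X| = ∑_{x ∈ π₀ X} 1 / |Ω_x X|`, one base point in each path component,
unfolded `m` times and stopped with the value `1`. The spaces reached after `n + 1` steps from an
`n`-truncated space are weakly contractible. -/
def homotopyCardinalityAux : ℕ → (X : Type u) → [TopologicalSpace X] → ℚ
  | 0, _, _ => 1
  | m + 1, X, _ => ∑ᶠ c : ZerothHomotopy X, 1 / homotopyCardinalityAux m (LoopSpace X c.out)

/-- The homotopy cardinality `|X|` of a `π`-finite space: if `X` is `n`-truncated (`n` least), the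
recursion `|X| = ∑_{x ∈ π₀ X} 1 / |Ω_x X|` is unfolded `n + 1` times, down to weakly contractible
spaces, which have cardinality `1`. -/
def homotopyCardinality (X : Type u) [TopologicalSpace X] : ℚ :=
  homotopyCardinalityAux (sInf {n : ℕ | IsTruncatedSpace n X} + 1) X

end

noncomputable section

/-! ### Homotopies between families of paths -/

/-! Unfolding the recursion, a component of a `π`-finite space contributes the alternating product
`∏ |π_k| ^ (-1) ^ k` over `k ≥ 1` to the cardinality (`loopFactor`,
`homotopyCardinality_eq_finsum`). Evaluation `ΛE → E` has homotopy fibre `Ω_x E` over `x`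
(`FreeLoopSpace.isHEquiv_toLoop`).

In a homotopy fibre sequence `F → T → B`, the long exact sequence makes the product for `T` at `t`
equal to the product for `F`, times that for `B`, times the number of components of `F` lying over
the component of `t` (`loopFactor_eq_mul`). The long exact sequence is never built as such: its
start is counted with `π₁` and `π₀` alone, and higher degrees follow by induction, since looping the
fibre of `f` gives the fibre of `Ωf`.

For `F ≃ Ω_x E` the products of `F` and `E` shift against each other and leave `1 / |π₁(E, x)|`. A
component of `ΛE` thus contributes the number of components of `Ω_x E` over it, divided by `|π₁(E,
x)|` (`FreeLoopSpace.loopFactor_eq_div`). Since `|π₀ Ω_x E| = |π₁(E, x)|`, the components of `ΛE`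
over a fixed component of `E` contribute `1` in total. -/

instance unitInterval.instContractibleSpace : ContractibleSpace I :=
  (convex_Icc (0 : ℝ) 1).contractibleSpace ⟨0, by simp⟩

section PathFamilies

variable {A C X Y Z : Type*} [TopologicalSpace A] [TopologicalSpace C] [TopologicalSpace X]
  [TopologicalSpace Y] [TopologicalSpace Z]

/-- The family of paths obtained by pushing a path `u` forward along a family of maps `K a` which
are independent of `a` at the end points of `u`. -/
def pathFamily (K : C(A × C, X)) {c₀ c₁ : C} {x y : X} (hx : ∀ a, K (a, c₀) = x)
    (hy : ∀ a, K (a, c₁) = y) (u : Path c₀ c₁) : C(A, Path x y) where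
  toFun a := ⟨⟨fun t => K (a, u t), by fun_prop⟩, by simp [hx], by simp [hy]⟩
  continuous_toFun := Path.continuous_uncurry_iff.1 (by
    change Continuous fun p : A × I => K (p.1, u p.2)
    fun_prop)

/-- Homotopic paths induce homotopic families of paths. -/
theorem pathFamily_homotopic (K : C(A × C, X)) {c₀ c₁ : C} {x y : X} (hx : ∀ a, K (a, c₀) = x)
    (hy : ∀ a, K (a, c₁) = y) {u v : Path c₀ c₁} (h : u.Homotopic v) :
    (pathFamily K hx hy u).Homotopic (pathFamily K hx hy v) := by
  obtain ⟨F⟩ := h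
  refine ⟨⟨⟨fun q => ⟨⟨fun t => K (q.2, F (q.1, t)), by fun_prop⟩, by simp [hx], by simp [hy]⟩,
    Path.continuous_uncurry_iff.1 ?_⟩, ?_, ?_⟩⟩
  · change Continuous fun p : (I × A) × I => K (p.1.2, F (p.1.1, p.2))
    fun_prop
  · intro a; ext t; simp [pathFamily]
  · intro a; ext t; simp [pathFamily]

/-- The main device for building homotopies: if two families read the same map `K` along two
parameter paths with common end points, simple connectedness of the parameter space makes them
homotopic. In practice `C` is an interval or a square. -/
theorem homotopic_of_pathFamily [SimplyConnectedSpace C] {x y : X}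
    {φ ψ : C(A, Path x y)} (K : C(A × C, X)) {c₀ c₁ : C} (u v : Path c₀ c₁)
    (hφ : ∀ a t, φ a t = K (a, u t)) (hψ : ∀ a t, ψ a t = K (a, v t)) : φ.Homotopic ψ := by
  have hx : ∀ a, K (a, c₀) = x := fun a => by simpa using (hφ a 0).symm
  have hy : ∀ a, K (a, c₁) = y := fun a => by simpa using (hφ a 1).symm
  have h := pathFamily_homotopic K hx hy (SimplyConnectedSpace.paths_homotopic u v)
  have h1 : pathFamily K hx hy u = φ := by ext a t; exact (hφ a t).symm
  have h2 : pathFamily K hx hy v = ψ := by ext a t; exact (hψ a t).symm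
  rwa [h1, h2] at h

/-- The action of a continuous map on path spaces. -/
@[simps]
def pathMap (f : C(X, Y)) (x y : X) : C(Path x y, Path (f x) (f y)) where
  toFun p := p.map f.continuous
  continuous_toFun := Path.continuous_uncurry_iff.1 (by
    change Continuous fun q : Path x y × I => f (q.1 q.2)
    fun_prop)

/-- Left translation of paths. -/
@[simps]
def pathTransLeft {x y : X} (a : Path x y) (z : X) : C(Path y z, Path x z) where
  toFun p := a.trans p
  continuous_toFun := continuous_const.path_trans continuous_id

/-- Right translation of paths. -/
@[simps]
def pathTransRight (x : X) {y z : X} (a : Path y z) : C(Path x y, Path x z) where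
  toFun p := p.trans a
  continuous_toFun := continuous_id.path_trans continuous_const

/-- Reversal of paths. -/
@[simps]
def pathSymm (x y : X) : C(Path x y, Path y x) where
  toFun p := p.symm
  continuous_toFun := Path.continuous_symm

/-- The first half of the unit interval. -/
def firstHalf : Path (0 : I) ⟨1 / 2, by norm_num, by norm_num⟩ where
  toFun t := ⟨t / 2, by have := t.2.1; positivity, by linarith [t.2.2]⟩
  source' := by ext; simp
  target' := by ext; simp

/-- The second half of the unit interval. -/
def secondHalf : Path (⟨1 / 2, by norm_num, by norm_num⟩ : I) 1 where
  toFun t := ⟨(1 + t) / 2, by have := t.2.1; positivity, by linarith [t.2.2]⟩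
  source' := by ext; simp
  target' := by ext; norm_num

theorem trans_firstHalf {x y z : X} (p : Path x y) (q : Path y z) (t : I) :
    p.trans q (firstHalf t) = p t := by
  rw [Path.trans_apply, dif_pos (by change (t : ℝ) / 2 ≤ 1 / 2; linarith [t.2.2])]
  congr 1
  ext
  change 2 * ((t : ℝ) / 2) = t
  ring

theorem trans_secondHalf {x y z : X} (p : Path x y) (q : Path y z) (t : I) :
    p.trans q (secondHalf t) = q t := by
  by_cases h : (t : ℝ) = 0
  · have ht : t = 0 := by ext; exact h
    subst ht
    simp only [secondHalf, Path.coe_mk_mk]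
    rw [Path.trans_apply, dif_pos (by norm_num)]
    simp
  · have h0 : 0 < (t : ℝ) := lt_of_le_of_ne t.2.1 (Ne.symm h)
    rw [Path.trans_apply, dif_neg (by change ¬ ((1 + t : ℝ) / 2 ≤ 1 / 2); linarith)]
    congr 1
    ext
    change 2 * ((1 + t : ℝ) / 2) - 1 = t
    ring

theorem map_trans_apply {c₀ c₁ c₂ : C} (u : Path c₀ c₁) (v : Path c₁ c₂) {x y z : X}
    (p : Path x y) (q : Path y z) (k : C → X) (hp : ∀ t, p t = k (u t)) (hq : ∀ t, q t = k (v t))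
    (t : I) : p.trans q t = k (u.trans v t) := by
  rw [Path.trans_apply, Path.trans_apply]
  split_ifs
  · exact hp _
  · exact hq _

/-- The concatenation of paths as a map of families. -/
def transFamily {x y z : X} (a : Path x y) : C(Path y z × I, X) where
  toFun q := a.trans q.1 q.2
  continuous_toFun := by
    have : Continuous fun p : Path y z => a.trans p := (pathTransLeft a z).continuous
    fun_prop

theorem pathTransLeft_symm_comp {x y : X} (a : Path x y) (z : X) :
    ((pathTransLeft a.symm z).comp (pathTransLeft a z)).Homotopic (ContinuousMap.id _) := by
  -- Both sides read `a.trans p`: one runs back from `1/2` to `0` and then forward to `1`, the other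
  -- goes directly from `1/2` to `1`.
  refine homotopic_of_pathFamily (transFamily a) (firstHalf.symm.trans Path.id) secondHalf ?_ ?_
  · intro p t
    refine map_trans_apply _ _ _ _ (fun c => transFamily a (p, c)) (fun t => ?_) (fun t => ?_) t
    · exact (trans_firstHalf a p (σ t)).symm
    · rfl
  · intro p t
    exact (trans_secondHalf a p t).symm

theorem pathTransLeft_comp_symm {x y : X} (a : Path x y) (z : X) :
    ((pathTransLeft a z).comp (pathTransLeft a.symm z)).Homotopic (ContinuousMap.id _) := by
  have h := pathTransLeft_symm_comp a.symm z
  rwa [Path.symm_symm] at h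

/-- A homotopy `H` from `f` to `g` gives a homotopy between `p ↦ f p * H y` and `p ↦ H x * g p`. -/
theorem pathMap_homotopic {f g : C(X, Y)} (H : f.Homotopy g) (x y : X) :
    ((pathTransRight (f x) (H.evalAt y)).comp (pathMap f x y)).Homotopic
      ((pathTransLeft (H.evalAt x) (g y)).comp (pathMap g x y)) := by
  let K : C(Path x y × (I × I), Y) := ⟨fun q => H (q.2.1, q.1 q.2.2), by fun_prop⟩
  -- The two ways around the boundary of the square from `(0, 0)` to `(1, 1)`.
  refine homotopic_of_pathFamily K
    (((Path.refl 0).prod Path.id).trans (Path.id.prod (Path.refl 1)))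
    ((Path.id.prod (Path.refl 0)).trans ((Path.refl 1).prod Path.id)) ?_ ?_
  · intro p t
    refine map_trans_apply _ _ _ _ (fun c => K (p, c)) (fun t => ?_) (fun t => ?_) t
    · exact (H.apply_zero (p t)).symm
    · exact (congrArg (fun z => H (t, z)) p.target).symm
  · intro p t
    refine map_trans_apply _ _ _ _ (fun c => K (p, c)) (fun t => ?_) (fun t => ?_) t
    · exact (congrArg (fun z => H (t, z)) p.source).symm
    · exact (H.apply_one (p t)).symm

end PathFamilies

/-! ### Homotopy equivalences -/

section HomotopyEquivalences

variable {X Y Z W : Type*} [TopologicalSpace X] [TopologicalSpace Y]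
  [TopologicalSpace Z] [TopologicalSpace W]

/-- A continuous map is a homotopy equivalence. -/
def IsHEquiv (f : C(X, Y)) : Prop :=
  ∃ g : C(Y, X), (g.comp f).Homotopic (ContinuousMap.id X) ∧
    (f.comp g).Homotopic (ContinuousMap.id Y)

namespace IsHEquiv

theorem of_homeomorph (e : X ≃ₜ Y) : IsHEquiv (e : C(X, Y)) :=
  ⟨(e.symm : C(Y, X)), by simp [ContinuousMap.Homotopic.refl], by
    simp [ContinuousMap.Homotopic.refl]⟩

theorem id : IsHEquiv (ContinuousMap.id X) := of_homeomorph (Homeomorph.refl X)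

theorem congr {f g : C(X, Y)} (hf : IsHEquiv f) (h : f.Homotopic g) : IsHEquiv g := by
  obtain ⟨k, h1, h2⟩ := hf
  exact ⟨k, ((ContinuousMap.Homotopic.refl k).comp h.symm).trans h1,
    (h.symm.comp (ContinuousMap.Homotopic.refl k)).trans h2⟩

theorem comp {g : C(Y, Z)} {f : C(X, Y)} (hg : IsHEquiv g) (hf : IsHEquiv f) :
    IsHEquiv (g.comp f) := by
  obtain ⟨g', g1, g2⟩ := hg
  obtain ⟨f', f1, f2⟩ := hf
  refine ⟨f'.comp g', ?_, ?_⟩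
  · exact ((ContinuousMap.Homotopic.refl f').comp
      (g1.comp (ContinuousMap.Homotopic.refl f))).trans f1
  · exact ((ContinuousMap.Homotopic.refl g).comp
      (f2.comp (ContinuousMap.Homotopic.refl g'))).trans g2

theorem of_left_right {f : C(X, Y)} {l r : C(Y, X)}
    (hl : (l.comp f).Homotopic (ContinuousMap.id X))
    (hr : (f.comp r).Homotopic (ContinuousMap.id Y)) : IsHEquiv f := by
  have h : l.Homotopic r :=
    ((ContinuousMap.Homotopic.refl l).comp hr.symm).trans (hl.comp (ContinuousMap.Homotopic.refl r))
  exact ⟨l, hl, ((ContinuousMap.Homotopic.refl f).comp h).trans hr⟩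

theorem inverse {f : C(X, Y)} (hf : IsHEquiv f) :
    ∃ g : C(Y, X), IsHEquiv g ∧ (g.comp f).Homotopic (ContinuousMap.id X) ∧
      (f.comp g).Homotopic (ContinuousMap.id Y) := by
  obtain ⟨g, h1, h2⟩ := hf
  exact ⟨g, ⟨f, h2, h1⟩, h1, h2⟩

theorem of_comp_left {g : C(Y, Z)} {f : C(X, Y)} (hg : IsHEquiv g) (h : IsHEquiv (g.comp f)) :
    IsHEquiv f := by
  obtain ⟨g', hg', g1, g2⟩ := hg.inverse
  exact (hg'.comp h).congr (g1.comp (ContinuousMap.Homotopic.refl f))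

/-- The two-out-of-six property. -/
theorem of_two_of_six {f : C(X, Y)} {g : C(Y, Z)} {k : C(Z, W)} (h1 : IsHEquiv (g.comp f))
    (h2 : IsHEquiv (k.comp g)) : IsHEquiv f := by
  obtain ⟨a, a1, a2⟩ := h1
  obtain ⟨b, b1, b2⟩ := h2
  have hg : IsHEquiv g := of_left_right (l := b.comp k) (r := f.comp a) b1 a2
  exact hg.of_comp_left ⟨a, a1, a2⟩

end IsHEquiv

theorem isHEquiv_pathTransLeft {x y : X} (a : Path x y) (z : X) : IsHEquiv (pathTransLeft a z) :=
  ⟨_, pathTransLeft_symm_comp a z, pathTransLeft_comp_symm a z⟩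

theorem isHEquiv_pathSymm (x y : X) : IsHEquiv (pathSymm x y) :=
  IsHEquiv.of_homeomorph ⟨⟨Path.symm, Path.symm, Path.symm_symm, Path.symm_symm⟩,
    Path.continuous_symm, Path.continuous_symm⟩

theorem isHEquiv_pathTransRight (x : X) {y z : X} (a : Path y z) :
    IsHEquiv (pathTransRight x a) := by
  have h := ((isHEquiv_pathSymm z x).comp (isHEquiv_pathTransLeft a.symm x)).comp
    (isHEquiv_pathSymm x y)
  convert! h using 1
  ext p t
  simp [Path.trans_symm]

/-- By `pathMap_homotopic`, the path map followed by a right translation is homotopic to a left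
translation; translations are equivalences. -/
theorem isHEquiv_pathMap_of_homotopic_id {f : C(X, X)}
    (h : f.Homotopic (ContinuousMap.id X)) (x y : X) : IsHEquiv (pathMap f x y) := by
  obtain ⟨H⟩ := h
  refine (isHEquiv_pathTransRight (f x) (H.evalAt y)).of_comp_left ?_
  refine IsHEquiv.congr ?_ (pathMap_homotopic H x y).symm
  exact (isHEquiv_pathTransLeft (H.evalAt x) y).comp IsHEquiv.id

/-- Homotopy equivalences induce homotopy equivalences of path spaces. -/
theorem IsHEquiv.pathMap {f : C(X, Y)} (hf : IsHEquiv f) (x y : X) :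
    IsHEquiv (pathMap f x y) := by
  obtain ⟨g, h1, h2⟩ := hf
  -- In the string of path maps of `f`, `g`, `f`, both consecutive composites come from self-maps
  -- homotopic to the identity.
  exact IsHEquiv.of_two_of_six (g := _root_.pathMap g (f x) (f y))
    (k := _root_.pathMap f (g (f x)) (g (f y)))
    (isHEquiv_pathMap_of_homotopic_id h1 x y) (isHEquiv_pathMap_of_homotopic_id h2 (f x) (f y))

end HomotopyEquivalences

/-! ### Path components and homotopy groups -/

section HomotopyGroups

variable {X Y : Type*} [TopologicalSpace X] [TopologicalSpace Y]

namespace ZerothHomotopy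

theorem mk_eq_mk {x y : X} : mk x = mk y ↔ Joined x y := Quotient.eq

theorem mk_out (c : ZerothHomotopy X) : mk c.out = c := Quotient.out_eq c

/-- The map on path components induced by a continuous map. -/
def map (f : C(X, Y)) : ZerothHomotopy X → ZerothHomotopy Y :=
  lift (fun x => mk (f x)) fun _ _ p => sound (p.map f.continuous)

theorem map_bijective {f : C(X, Y)} (hf : IsHEquiv f) : Function.Bijective (map f) := by
  obtain ⟨g, ⟨H⟩, ⟨H'⟩⟩ := hf
  refine Function.bijective_iff_has_inverse.2 ⟨map g, fun c => ?_, fun c => ?_⟩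
  · induction c with
    | mk x => exact sound (H.evalAt x)
  · induction c with
    | mk x => exact sound (H'.evalAt x)

end ZerothHomotopy

theorem joined_path_iff_homotopic {x y : X} {p q : Path x y} : Joined p q ↔ p.Homotopic q := by
  constructor
  · rintro ⟨h⟩
    refine ⟨⟨⟨⟨fun r => h r.1 r.2, by fun_prop⟩, fun t => ?_, fun t => ?_⟩, fun s t ht => ?_⟩⟩
    · simp
    · simp
    · rcases ht with rfl | rfl <;> simp
  · rintro ⟨F⟩
    refine ⟨⟨⟨fun s => F.eval s, Path.continuous_uncurry_iff.1 ?_⟩, F.eval_zero, F.eval_one⟩⟩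
    exact F.continuous

/-- Homotopy groups are the sets of path components of the spaces of generalized loops. -/
def homotopyGroupEquivZerothHomotopy (N : Type*) (x : X) :
    HomotopyGroup N X x ≃ ZerothHomotopy (GenLoop N X x) :=
  Quotient.congr (Equiv.refl _) fun f g => by
    constructor
    · rintro ⟨H⟩
      refine ⟨⟨⟨fun t => ⟨⟨fun s => H (t, s), by fun_prop⟩, fun y hy => ?_⟩, ?_⟩, ?_, ?_⟩⟩
      · exact (H.eq_fst t hy).trans (f.2 y hy)
      · refine Continuous.subtype_mk ?_ _
        exact ContinuousMap.continuous_of_continuous_uncurry _ H.continuous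
      · ext s; exact H.apply_zero s
      · ext s; exact H.apply_one s
    · rintro ⟨p⟩
      refine ⟨⟨⟨⟨fun q => p q.1 q.2, ?_⟩, fun s => ?_, fun s => ?_⟩, fun t s hs => ?_⟩⟩
      · fun_prop
      · exact congrArg (fun l : GenLoop N X x => l s) p.source
      · exact congrArg (fun l : GenLoop N X x => l s) p.target
      · exact ((p t).2 s hs).trans (f.2 s hs).symm

/-- One-dimensional generalized loops are loops. -/
def genLoopUnitHomeo (x : X) : GenLoop Unit X x ≃ₜ LoopSpace X x where
  toEquiv := genLoopEquivOfUnique Unit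
  continuous_toFun := Path.continuous_uncurry_iff.1 (by
    change Continuous fun q : GenLoop Unit X x × I => q.1 fun _ => q.2
    fun_prop)
  continuous_invFun := by
    refine Continuous.subtype_mk ?_ _
    refine ContinuousMap.continuous_of_continuous_uncurry _ ?_
    change Continuous fun q : LoopSpace X x × (Unit → I) => q.1 (q.2 default)
    fun_prop

/-- Homeomorphisms induce homeomorphisms of spaces of generalized loops. -/
def genLoopMapHomeo (N : Type*) (e : X ≃ₜ Y) {x : X} {y : Y} (h : e x = y) :
    GenLoop N X x ≃ₜ GenLoop N Y y where
  toFun p := ⟨(e : C(X, Y)).comp p.1, fun s hs => by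
    change e (p s) = y
    rw [GenLoop.boundary p s hs, h]⟩
  invFun p := ⟨(e.symm : C(Y, X)).comp p.1, fun s hs => by
    change e.symm (p s) = x
    rw [GenLoop.boundary p s hs, ← h, e.symm_apply_apply]⟩
  left_inv p := by ext s; exact e.symm_apply_apply _
  right_inv p := by ext s; exact e.apply_symm_apply _
  continuous_toFun := by
    refine Continuous.subtype_mk ?_ _
    exact (ContinuousMap.continuous_postcomp _).comp continuous_subtype_val
  continuous_invFun := by
    refine Continuous.subtype_mk ?_ _
    exact (ContinuousMap.continuous_postcomp _).comp continuous_subtype_val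

/-- Homeomorphic spaces have equivalent sets of path components. -/
def Homeomorph.zerothHomotopyCongr (e : X ≃ₜ Y) : ZerothHomotopy X ≃ ZerothHomotopy Y :=
  Equiv.ofBijective _ (ZerothHomotopy.map_bijective (IsHEquiv.of_homeomorph e))

/-- The homotopy groups of the loop space. -/
def homotopyGroupSuccEquiv (k : ℕ) (x : X) :
    π_ (k + 1) X x ≃ π_ k (LoopSpace X x) (Path.refl x) :=
  (homotopyGroupEquivZerothHomotopy (Fin (k + 1)) x).trans <|
    (Homeomorph.zerothHomotopyCongr <|
      (GenLoop.congr x ((finSumFinEquiv (m := k) (n := 1)).symm.trans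
        ((Equiv.refl _).sumCongr (Equiv.ofUnique (Fin 1) Unit)))).trans <|
      (GenLoop.genLoopGenLoopEquiv x).symm.trans <|
      genLoopMapHomeo (Fin k) (genLoopUnitHomeo x) (by ext t; rfl)).trans
    (homotopyGroupEquivZerothHomotopy (Fin k) (Path.refl x)).symm

/-- The first homotopy group is the set of path components of the loop space. -/
def homotopyGroupOneEquiv (x : X) : π_ 1 X x ≃ ZerothHomotopy (LoopSpace X x) :=
  (homotopyGroupSuccEquiv 0 x).trans HomotopyGroup.pi0EquivZerothHomotopy

/-- Induction through `π_{k+1}(X) = π_k(ΩX)`, as an equivalence loops to an equivalence. Bare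
bijections suffice, because only cardinalities matter later. -/
theorem nonempty_homotopyGroup_equiv_of_isHEquiv (k : ℕ) : ∀ {X : Type u} {Y : Type v}
    [TopologicalSpace X] [TopologicalSpace Y] {f : C(X, Y)} (_ : IsHEquiv f) (x : X),
    Nonempty (π_ k X x ≃ π_ k Y (f x)) := by
  induction k with
  | zero =>
    intro X Y _ _ f hf x
    exact ⟨HomotopyGroup.pi0EquivZerothHomotopy.trans
      ((Equiv.ofBijective _ (ZerothHomotopy.map_bijective hf)).trans
        HomotopyGroup.pi0EquivZerothHomotopy.symm)⟩
  | succ k ih =>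
    intro X Y _ _ f hf x
    obtain ⟨e⟩ := ih (hf.pathMap x x) (Path.refl x)
    exact ⟨(homotopyGroupSuccEquiv k x).trans (e.trans (homotopyGroupSuccEquiv k (f x)).symm)⟩

/-- Conjugation by a path is an equivalence of loop spaces. It sends the constant loop only to a
loop homotopic to the constant one, so the induction hypothesis is used again inside the loop space.
-/
theorem nonempty_homotopyGroup_equiv_of_joined (k : ℕ) : ∀ {X : Type u} [TopologicalSpace X]
    {x y : X} (_ : Joined x y), Nonempty (π_ k X x ≃ π_ k X y) := by
  induction k with
  | zero =>
    intro X _ x y _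
    exact ⟨HomotopyGroup.pi0EquivZerothHomotopy.trans HomotopyGroup.pi0EquivZerothHomotopy.symm⟩
  | succ k ih =>
    rintro X _ x y ⟨a⟩
    have h := (isHEquiv_pathTransLeft a.symm y).comp (isHEquiv_pathTransRight x a)
    obtain ⟨e⟩ := nonempty_homotopyGroup_equiv_of_isHEquiv k h (Path.refl x)
    have hj : Joined (a.symm.trans ((Path.refl x).trans a)) (Path.refl y) := by
      have h1 : (a.symm.trans ((Path.refl x).trans a)).Homotopic (Path.refl y) :=
        ((Path.Homotopic.refl _).hcomp ⟨Path.Homotopy.reflTrans a⟩).trans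
          ⟨(Path.Homotopy.reflSymmTrans a).symm⟩
      exact joined_path_iff_homotopic.2 h1
    obtain ⟨e'⟩ := ih hj
    exact ⟨(homotopyGroupSuccEquiv k x).trans
      (e.trans (e'.trans (homotopyGroupSuccEquiv k y).symm))⟩

/-- All components of a loop space have the same homotopy groups. -/
theorem nonempty_homotopyGroup_loopSpace_equiv (k : ℕ) {x : X} (p : LoopSpace X x) :
    Nonempty (π_ k (LoopSpace X x) (Path.refl x) ≃ π_ k (LoopSpace X x) p) := by
  obtain ⟨e⟩ := nonempty_homotopyGroup_equiv_of_isHEquiv k (isHEquiv_pathTransLeft p x)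
    (Path.refl x)
  obtain ⟨e'⟩ := nonempty_homotopyGroup_equiv_of_joined k
    (joined_path_iff_homotopic.2 (⟨Path.Homotopy.transRefl p⟩ : (p.trans (Path.refl x)).Homotopic p))
  exact ⟨e.trans e'⟩

end HomotopyGroups

/-! ### Homotopy fibres -/

section HomotopyFibres

theorem homotopic_of_simplyConnected {C X : Type*} [TopologicalSpace C] [TopologicalSpace X]
    [SimplyConnectedSpace C] {x y : X} {p q : Path x y} (K : C(C, X)) {c₀ c₁ : C}
    (u v : Path c₀ c₁) (hp : ∀ t, p t = K (u t)) (hq : ∀ t, q t = K (v t)) : p.Homotopic q := by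
  obtain ⟨H⟩ := homotopic_of_pathFamily (A := Unit) (φ := .const _ p) (ψ := .const _ q)
    (K.comp ⟨Prod.snd, continuous_snd⟩) u v (fun _ => hp) (fun _ => hq)
  exact joined_path_iff_homotopic.1 ⟨H.evalAt ()⟩

variable {T : Type u} {B : Type v} [TopologicalSpace T] [TopologicalSpace B]

/-- The homotopy fibre of `f` over `b`: points `t` with a path from `f t` to `b`. -/
abbrev HomotopyFibre (f : C(T, B)) (b : B) : Type (max u v) :=
  {e : T × C(I, B) // e.2 0 = f e.1 ∧ e.2 1 = b}

namespace HomotopyFibre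

variable {f : C(T, B)} {b b' : B}

/-- The path underlying a point of the homotopy fibre. -/
def path (e : HomotopyFibre f b) : Path (f e.1.1) b := ⟨e.1.2, e.2.1, e.2.2⟩

/-- Points of the homotopy fibre over a given point. -/
def ofPath (t : T) : C(Path (f t) b, HomotopyFibre f b) where
  toFun γ := ⟨(t, γ), γ.source, γ.target⟩
  continuous_toFun := by
    refine Continuous.subtype_mk (Continuous.prodMk continuous_const ?_) _
    exact continuous_induced_dom

variable (f b) in
/-- The projection of the homotopy fibre. -/
def proj : C(HomotopyFibre f b, T) := ⟨fun e => e.1.1, by fun_prop⟩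

/-- A path in the fibre sweeps out a square in `B` whose edges are the two paths to `b`, the image
of the projected path, and a constant edge at `b`. -/
theorem homotopic_of_path {e e' : HomotopyFibre f b} (h : Path e e') :
    e.path.Homotopic (((h.map (proj f b).continuous).map f.continuous).trans e'.path) := by
  let K : C(I × I, B) := ⟨fun q => (h q.1).1.2 q.2, by
    have h1 : Continuous fun s => (h s).1.2 := by fun_prop
    fun_prop⟩
  have h1 : (e.path.trans (Path.refl b)).Homotopic
      (((h.map (proj f b).continuous).map f.continuous).trans e'.path) := by
    refine homotopic_of_simplyConnected K
      (((Path.refl 0).prod Path.id).trans (Path.id.prod (Path.refl 1)))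
      ((Path.id.prod (Path.refl 0)).trans ((Path.refl 1).prod Path.id)) ?_ ?_
    · intro t
      refine map_trans_apply _ _ _ _ K (fun t => ?_) (fun t => ?_) t
      · exact (congrArg (fun z : HomotopyFibre f b => z.1.2 t) h.source).symm
      · exact (h t).2.2.symm
    · intro t
      refine map_trans_apply _ _ _ _ K (fun t => ?_) (fun t => ?_) t
      · exact (h t).2.1.symm
      · exact (congrArg (fun z : HomotopyFibre f b => z.1.2 t) h.target).symm
  exact Path.Homotopic.trans ⟨(Path.Homotopy.transRefl _).symm⟩ h1

/-- The reparametrization of the interval `[s / 2, 1]`. -/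
def tailParam (q : I × I) : I :=
  ⟨q.1 / 2 + (1 - q.1 / 2) * q.2, by
    have h1 := q.1.2.1
    have h2 := q.1.2.2
    have h3 := q.2.2.1
    have : (0 : ℝ) ≤ 1 - q.1 / 2 := by linarith
    positivity, by
    have h1 := q.1.2.1
    have h2 := q.1.2.2
    have h3 := q.2.2.2
    nlinarith⟩

theorem continuous_tailParam : Continuous tailParam := by
  unfold tailParam
  fun_prop

/-- Slide the starting point along `α`: at time `s` it is `α s`, and the path to `b` is the
restriction of the concatenation to `[s / 2, 1]`. -/
theorem joined_ofPath_map_trans {t t' : T} (α : Path t t') (γ : Path (f t') b) :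
    Joined (ofPath (f := f) t ((α.map f.continuous).trans γ)) (ofPath t' γ) := by
  let p := (α.map f.continuous).trans γ
  have hc : Continuous fun q : I × I => p (tailParam q) := p.continuous.comp continuous_tailParam
  refine ⟨⟨⟨fun s => ⟨(α s, ⟨fun r => p (tailParam (s, r)), hc.comp (.prodMk_right s)⟩), ?_, ?_⟩, ?_⟩, ?_, ?_⟩⟩
  · change p (tailParam (s, 0)) = _
    have : tailParam (s, 0) = firstHalf s := by ext; simp [tailParam, firstHalf]
    rw [this]
    exact trans_firstHalf _ _ s
  · change p (tailParam (s, 1)) = _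
    have : tailParam (s, 1) = 1 := by ext; simp [tailParam]
    rw [this]
    exact p.target
  · refine Continuous.subtype_mk (Continuous.prodMk α.continuous ?_) _
    exact ContinuousMap.continuous_of_continuous_uncurry _ hc
  · refine Subtype.ext (Prod.ext α.source ?_)
    ext r
    change p (tailParam (0, r)) = p r
    congr 1
    ext; simp [tailParam]
  · refine Subtype.ext (Prod.ext α.target ?_)
    ext r
    change p (tailParam (1, r)) = γ r
    have : tailParam (1, r) = secondHalf r := by
      ext; simp [tailParam, secondHalf]; ring
    rw [this]
    exact trans_secondHalf _ _ r

theorem joined_ofPath_iff {t t' : T} {γ : Path (f t) b} {γ' : Path (f t') b} :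
    Joined (ofPath t γ) (ofPath t' γ') ↔
      ∃ α : Path t t', γ.Homotopic ((α.map f.continuous).trans γ') := by
  constructor
  · rintro ⟨h⟩
    exact ⟨h.map (proj f b).continuous, homotopic_of_path h⟩
  · rintro ⟨α, h⟩
    refine Joined.trans ?_ (joined_ofPath_map_trans α γ')
    obtain ⟨P⟩ := joined_path_iff_homotopic.2 h
    exact ⟨P.map (ofPath t).continuous⟩

/-- Change of base point along a path, on path components of homotopy fibres. -/
def transport (δ : Path b b') :
    ZerothHomotopy (HomotopyFibre f b) → ZerothHomotopy (HomotopyFibre f b') :=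
  ZerothHomotopy.lift (fun e => .mk (ofPath e.1.1 (e.path.trans δ))) fun e e' h => by
    refine ZerothHomotopy.mk_eq_mk.2 (joined_ofPath_iff.2 ⟨h.map (proj f b).continuous, ?_⟩)
    have h1 := (homotopic_of_path h).hcomp (Path.Homotopic.refl δ)
    exact h1.trans ⟨Path.Homotopy.transAssoc _ _ _⟩

theorem transport_transport_symm (δ : Path b b') (c : ZerothHomotopy (HomotopyFibre f b)) :
    transport δ.symm (transport δ c) = c := by
  induction c with
  | mk e =>
    refine ZerothHomotopy.mk_eq_mk.2
      ((joined_ofPath_iff (γ' := e.path)).2 ⟨Path.refl e.1.1, ?_⟩)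
    change ((e.path.trans δ).trans δ.symm).Homotopic ((Path.refl _).trans e.path)
    rw [← Path.Homotopic.Quotient.eq]
    simp [Path.Homotopic.Quotient.mk_trans, Path.Homotopic.Quotient.mk_symm,
      Path.Homotopic.Quotient.trans_assoc]

theorem map_proj_transport (δ : Path b b') (c : ZerothHomotopy (HomotopyFibre f b)) :
    ZerothHomotopy.map (proj f b') (transport δ c) = ZerothHomotopy.map (proj f b) c := by
  induction c with
  | mk e => rfl

variable (f b) in
/-- The path components of the homotopy fibre over `b` which lie over the path component `d`. -/
abbrev ComponentsOver (d : ZerothHomotopy T) :=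
  {c : ZerothHomotopy (HomotopyFibre f b) // ZerothHomotopy.map (proj f b) c = d}

/-- Change of base point, on path components over a given component. -/
def componentsOverEquiv (δ : Path b b') (d : ZerothHomotopy T) :
    ComponentsOver f b d ≃ ComponentsOver f b' d where
  toFun c := ⟨transport δ c.1, (map_proj_transport δ c.1).trans c.2⟩
  invFun c := ⟨transport δ.symm c.1, (map_proj_transport δ.symm c.1).trans c.2⟩
  left_inv c := Subtype.ext (transport_transport_symm δ c.1)
  right_inv c := Subtype.ext (by
    have := transport_transport_symm δ.symm c.1
    rwa [Path.symm_symm] at this)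

/-- With `map_map_proj`, this is exactness at `π₀ T`. -/
theorem exists_map_proj_eq {d : ZerothHomotopy T} (h : ZerothHomotopy.map f d = .mk b) :
    ∃ c, ZerothHomotopy.map (proj f b) c = d := by
  induction d with
  | mk t =>
    obtain ⟨γ⟩ := ZerothHomotopy.mk_eq_mk.1 h
    exact ⟨.mk (ofPath t γ), rfl⟩

theorem map_map_proj (c : ZerothHomotopy (HomotopyFibre f b)) :
    ZerothHomotopy.map f (ZerothHomotopy.map (proj f b) c) = .mk b := by
  induction c with
  | mk e => exact ZerothHomotopy.sound e.path

variable (f) in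
/-- The base point of the homotopy fibre over `f t`. -/
abbrev base (t : T) : HomotopyFibre f (f t) := ofPath t (Path.refl (f t))

variable (f) in
/-- The loop space of a homotopy fibre is the homotopy fibre of the map of loop spaces. -/
def loopHomeo (t : T) :
    LoopSpace (HomotopyFibre f (f t)) (base f t) ≃ₜ
      HomotopyFibre (pathMap f t t) (Path.refl (f t)) where
  -- Both sides consist of a loop in `T` and a square in `B`; the homeomorphism exchanges the two
  -- coordinates of the square.
  toFun l := ⟨(l.map (proj f (f t)).continuous,
    ⟨fun r => ⟨⟨fun s => (l s).1.2 r, by fun_prop⟩, by simp; rfl, by simp; rfl⟩,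
      Path.continuous_uncurry_iff.1 (by
        have h1 : Continuous fun s => (l s).1.2 := by fun_prop
        change Continuous fun q : I × I => (l q.2).1.2 q.1
        fun_prop)⟩), by ext s; exact (l s).2.1, by ext s; exact (l s).2.2⟩
  invFun e := ⟨⟨fun s => ⟨(e.1.1 s, ⟨fun r => e.1.2 r s, by fun_prop⟩),
      congrArg (fun p : Path (f t) (f t) => p s) e.2.1,
      congrArg (fun p : Path (f t) (f t) => p s) e.2.2⟩, by
        refine Continuous.subtype_mk (Continuous.prodMk e.1.1.continuous ?_) _
        refine ContinuousMap.continuous_of_continuous_uncurry _ ?_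
        change Continuous fun q : I × I => e.1.2 q.2 q.1
        fun_prop⟩,
    Subtype.ext (Prod.ext e.1.1.source (by ext r; exact (e.1.2 r).source)),
    Subtype.ext (Prod.ext e.1.1.target (by ext r; exact (e.1.2 r).target))⟩
  left_inv l := rfl
  right_inv e := rfl
  continuous_toFun := by
    refine Continuous.subtype_mk (Continuous.prodMk (pathMap (proj f (f t)) _ _).continuous ?_) _
    refine ContinuousMap.continuous_of_continuous_uncurry _ ?_
    refine Path.continuous_uncurry_iff.1 ?_
    change Continuous fun q : (LoopSpace (HomotopyFibre f (f t)) (base f t) × I) × I =>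
      (q.1.1 q.2).1.2 q.1.2
    have h1 : Continuous fun q : (LoopSpace (HomotopyFibre f (f t)) (base f t) × I) × I =>
      (q.1.1 q.2).1.2 := by fun_prop
    fun_prop
  continuous_invFun := by
    refine Path.continuous_uncurry_iff.1 ?_
    refine Continuous.subtype_mk (Continuous.prodMk ?_ ?_) _
    · change Continuous fun q : HomotopyFibre (pathMap f t t) (Path.refl (f t)) × I => q.1.1.1 q.2
      fun_prop
    · refine ContinuousMap.continuous_of_continuous_uncurry _ ?_
      change Continuous fun q : (HomotopyFibre (pathMap f t t) (Path.refl (f t)) × I) × I =>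
        q.1.1.1.2 q.2 q.1.2
      fun_prop

theorem proj_loopHomeo (t : T) (l : LoopSpace (HomotopyFibre f (f t)) (base f t)) :
    proj _ _ (loopHomeo f t l) = l.map (proj f (f t)).continuous := rfl

end HomotopyFibre

end HomotopyFibres

/-! ### Counting in the long exact sequence of a homotopy fibre -/

section ExactSequence

variable {T : Type u} {B : Type v} [TopologicalSpace T] [TopologicalSpace B]

/-- The fundamental group is the set of path components of the loop space. -/
def fundamentalGroupEquivZerothHomotopy (t : T) :
    FundamentalGroup T t ≃ ZerothHomotopy (LoopSpace T t) :=
  Quotient.congr (Equiv.refl _) fun _ _ => joined_path_iff_homotopic.symm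

theorem card_homotopyGroup_one (t : T) :
    Nat.card (π_ 1 T t) = Nat.card (FundamentalGroup T t) :=
  Nat.card_congr ((homotopyGroupOneEquiv t).trans (fundamentalGroupEquivZerothHomotopy t).symm)

theorem fundamentalGroup_map_mk (f : C(T, B)) {t : T} (α : Path t t) :
    FundamentalGroup.map f t (Path.Homotopic.Quotient.mk α) =
      Path.Homotopic.Quotient.mk (α.map f.continuous) := rfl

namespace HomotopyFibre

variable (f : C(T, B)) (t : T)

/-- The connecting map from the fundamental group of the base to the components of the fibre. -/
def connecting (g : FundamentalGroup B (f t)) : ComponentsOver f (f t) (.mk t) :=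
  ⟨Quotient.liftOn (s := Path.Homotopic.setoid _ _) g (fun γ => .mk (ofPath t γ)) fun γ γ' h => by
      refine ZerothHomotopy.mk_eq_mk.2 (joined_ofPath_iff.2 ⟨Path.refl t, ?_⟩)
      exact Path.Homotopic.trans h ⟨(Path.Homotopy.reflTrans γ').symm⟩, by
    induction g using Path.Homotopic.Quotient.ind with
    | mk γ => rfl⟩

theorem connecting_surjective : Function.Surjective (connecting f t) := by
  rintro ⟨c, hc⟩
  induction c with
  | mk e =>
    obtain ⟨α⟩ := ZerothHomotopy.mk_eq_mk.1 hc
    refine ⟨Path.Homotopic.Quotient.mk ((α.symm.map f.continuous).trans e.path), Subtype.ext ?_⟩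
    exact ZerothHomotopy.mk_eq_mk.2 (joined_ofPath_map_trans α.symm e.path)

/-- The fibres of the connecting map are the left cosets of the image of `π₁ T`, which is exactness
at `π₁ B`. -/
theorem connecting_eq_iff (g h : FundamentalGroup B (f t)) :
    connecting f t g = connecting f t h ↔ g⁻¹ * h ∈ (FundamentalGroup.map f t).range := by
  induction g using Path.Homotopic.Quotient.ind with
  | mk γ =>
  induction h using Path.Homotopic.Quotient.ind with
  | mk γ' =>
  -- The product `g * h` of classes is `h` followed by `g`, so the relation is turned around to put
  -- the loop from `T` in front of `γ`.
  have h1 : connecting f t (Path.Homotopic.Quotient.mk γ) =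
      connecting f t (Path.Homotopic.Quotient.mk γ') ↔
        Joined (ofPath (f := f) t γ') (ofPath t γ) := by
    rw [Subtype.ext_iff]
    exact ZerothHomotopy.mk_eq_mk.trans ⟨Joined.symm, Joined.symm⟩
  rw [h1, joined_ofPath_iff]
  constructor
  · rintro ⟨α, h⟩
    refine ⟨Path.Homotopic.Quotient.mk α, ?_⟩
    rw [eq_inv_mul_iff_mul_eq]
    exact (Path.Homotopic.Quotient.eq.2 h).symm
  · rintro ⟨a, h⟩
    induction a using Path.Homotopic.Quotient.ind with
    | mk α =>
    rw [eq_inv_mul_iff_mul_eq] at h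
    exact ⟨α, Path.Homotopic.Quotient.eq.1 h.symm⟩

theorem card_fundamentalGroup_base :
    Nat.card (FundamentalGroup B (f t)) =
      Nat.card (ComponentsOver f (f t) (.mk t)) * Nat.card (FundamentalGroup.map f t).range := by
  rw [Subgroup.card_eq_card_quotient_mul_card_subgroup (FundamentalGroup.map f t).range]
  congr 1
  refine Nat.card_congr (Equiv.trans ?_
    (Setoid.quotientKerEquivOfSurjective _ (connecting_surjective f t)))
  refine Quotient.congr (Equiv.refl _) fun g h => ?_
  rw [QuotientGroup.leftRel_apply]
  exact (connecting_eq_iff f t g h).symm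

/-- The map on fundamental groups induced by the projection of the homotopy fibre. -/
abbrev projHom : FundamentalGroup (HomotopyFibre f (f t)) (base f t) →* FundamentalGroup T t :=
  FundamentalGroup.map (proj f (f t)) (base f t)

/-- Exactness at `π₁ T`: a null-homotopy of the image of `α` is exactly what lifts `α` to a loop in
the fibre, through `loopHomeo`. -/
theorem range_projHom : (projHom f t).range = (FundamentalGroup.map f t).ker := by
  ext a
  induction a using Path.Homotopic.Quotient.ind with
  | mk α =>
  rw [MonoidHom.mem_ker, fundamentalGroup_map_mk]
  constructor
  · rintro ⟨l, hl⟩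
    induction l using Path.Homotopic.Quotient.ind with
    | mk l =>
    have h : Path.Homotopic.Quotient.mk α =
        Path.Homotopic.Quotient.mk (proj _ _ (loopHomeo f t l)) := hl.symm
    rw [Path.Homotopic.Quotient.eq] at h
    exact Path.Homotopic.Quotient.eq.2
      ((h.map f).trans (joined_path_iff_homotopic.1 ⟨(loopHomeo f t l).path⟩))
  · intro h
    obtain ⟨β⟩ := joined_path_iff_homotopic.2
      (Path.Homotopic.Quotient.eq.1 (h : _ = Path.Homotopic.Quotient.mk (Path.refl (f t))))
    refine ⟨Path.Homotopic.Quotient.mk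
      ((loopHomeo f t).symm (ofPath (f := pathMap f t t) α β)), ?_⟩
    have h1 := proj_loopHomeo t ((loopHomeo f t).symm (ofPath (f := pathMap f t t) α β))
    rw [Homeomorph.apply_symm_apply] at h1
    exact congrArg Path.Homotopic.Quotient.mk h1.symm

/-- This replaces the cokernel of `π₂ T → π₂ B`: classes in the kernel are components of the fibre
of `Ωf` lying over the component of the constant loop. -/
theorem card_ker_projHom :
    Nat.card (projHom f t).ker =
      Nat.card (ComponentsOver (pathMap f t t) (pathMap f t t (Path.refl t))
        (.mk (Path.refl t))) := by
  refine Nat.card_congr (Equiv.subtypeEquiv ((fundamentalGroupEquivZerothHomotopy _).trans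
    (Homeomorph.zerothHomotopyCongr (loopHomeo f t))) fun l => ?_)
  induction l using Path.Homotopic.Quotient.ind with
  | mk l =>
  rw [MonoidHom.mem_ker]
  exact (Path.Homotopic.Quotient.eq (p := l.map (proj f (f t)).continuous) (q := Path.refl t)).trans
    (joined_path_iff_homotopic.symm.trans ZerothHomotopy.mk_eq_mk.symm)

theorem card_subgroup_mul {G H : Type*} [Group G] [Group H] (φ : G →* H) :
    Nat.card φ.range * Nat.card φ.ker = Nat.card G := by
  rw [Subgroup.card_eq_card_quotient_mul_card_subgroup φ.ker,
    Nat.card_congr (QuotientGroup.quotientKerEquivRange φ).toEquiv]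

/-- The counting form of exactness of the beginning of the long exact sequence. -/
theorem card_homotopyGroup_one_mul :
    Nat.card (π_ 1 (HomotopyFibre f (f t)) (base f t)) * Nat.card (π_ 1 B (f t)) =
      Nat.card (ComponentsOver (pathMap f t t) (pathMap f t t (Path.refl t))
        (.mk (Path.refl t))) * Nat.card (π_ 1 T t) *
      Nat.card (ComponentsOver f (f t) (.mk t)) := by
  -- Both sides become `|ker p| * |ker f| * |im f|` times the number of components over `t`, where
  -- `p` and `f` denote the maps on `π₁`.
  rw [card_homotopyGroup_one, card_homotopyGroup_one, card_homotopyGroup_one,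
    ← card_subgroup_mul (projHom f t), card_ker_projHom, range_projHom,
    card_fundamentalGroup_base, ← card_subgroup_mul (FundamentalGroup.map f t)]
  ring

theorem nonempty_homotopyGroup_succ_equiv (k : ℕ) :
    Nonempty (π_ k (HomotopyFibre (pathMap f t t) (pathMap f t t (Path.refl t)))
      (base (pathMap f t t) (Path.refl t)) ≃
        π_ (k + 1) (HomotopyFibre f (f t)) (base f t)) := by
  obtain ⟨e⟩ := nonempty_homotopyGroup_equiv_of_isHEquiv k
    (IsHEquiv.of_homeomorph (loopHomeo f t)) (Path.refl _)
  exact ⟨e.symm.trans (homotopyGroupSuccEquiv k _).symm⟩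

theorem finite_homotopyGroup_one [Finite (π_ 1 (HomotopyFibre f (f t)) (base f t))]
    [Finite (π_ 1 B (f t))] : Finite (π_ 1 T t) := by
  have h1 : Finite (FundamentalGroup (HomotopyFibre f (f t)) (base f t)) :=
    Finite.of_equiv _ ((homotopyGroupOneEquiv _).trans
      (fundamentalGroupEquivZerothHomotopy _).symm)
  have h2 : Finite (FundamentalGroup B (f t)) :=
    Finite.of_equiv _ ((homotopyGroupOneEquiv _).trans
      (fundamentalGroupEquivZerothHomotopy _).symm)
  have h3 : Finite (FundamentalGroup T t) := by
    refine Nat.finite_of_card_ne_zero ?_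
    rw [← card_subgroup_mul (FundamentalGroup.map f t), ← range_projHom]
    have h4 : Finite (projHom f t).range := Set.finite_range (projHom f t)
    exact mul_ne_zero Nat.card_pos.ne' Nat.card_pos.ne'
  exact Finite.of_equiv _ ((homotopyGroupOneEquiv _).trans
      (fundamentalGroupEquivZerothHomotopy _).symm).symm

theorem subsingleton_homotopyGroup_one [Subsingleton (π_ 1 (HomotopyFibre f (f t)) (base f t))]
    [Subsingleton (π_ 1 B (f t))] : Subsingleton (π_ 1 T t) := by
  have := finite_homotopyGroup_one f t
  have h := card_homotopyGroup_one_mul f t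
  rw [Nat.card_unique (α := π_ 1 B (f t)),
    Nat.card_unique (α := π_ 1 (HomotopyFibre f (f t)) (base f t))] at h
  refine (Nat.card_eq_one_iff_unique.1 ?_).1
  exact Nat.eq_one_of_mul_eq_one_left (Nat.eq_one_of_mul_eq_one_right h.symm)

/-- Degree one is exactness at `π₁ T`; higher degrees reduce to it by passing to `Ωf`. -/
theorem finite_homotopyGroup (k : ℕ) : ∀ {T : Type u} {B : Type v} [TopologicalSpace T]
    [TopologicalSpace B] (f : C(T, B)) (t : T)
    (_ : Finite (π_ (k + 1) (HomotopyFibre f (f t)) (base f t)))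
    (_ : Finite (π_ (k + 1) B (f t))), Finite (π_ (k + 1) T t) := by
  induction k with
  | zero => intro T B _ _ f t _ _; exact finite_homotopyGroup_one f t
  | succ k ih =>
    intro T B _ _ f t _ _
    obtain ⟨e⟩ := nonempty_homotopyGroup_succ_equiv f t (k + 1)
    have := ih (pathMap f t t) (Path.refl t) (Finite.of_equiv _ e.symm)
      (Finite.of_equiv _ (homotopyGroupSuccEquiv (k + 1) (f t)))
    exact Finite.of_equiv _ (homotopyGroupSuccEquiv (k + 1) t).symm

theorem subsingleton_homotopyGroup (k : ℕ) : ∀ {T : Type u} {B : Type v} [TopologicalSpace T]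
    [TopologicalSpace B] (f : C(T, B)) (t : T)
    (_ : Subsingleton (π_ (k + 1) (HomotopyFibre f (f t)) (base f t)))
    (_ : Subsingleton (π_ (k + 1) B (f t))), Subsingleton (π_ (k + 1) T t) := by
  induction k with
  | zero => intro T B _ _ f t _ _; exact subsingleton_homotopyGroup_one f t
  | succ k ih =>
    intro T B _ _ f t _ _
    obtain ⟨e⟩ := nonempty_homotopyGroup_succ_equiv f t (k + 1)
    have := ih (pathMap f t t) (Path.refl t) e.subsingleton
      (homotopyGroupSuccEquiv (k + 1) (f t)).symm.subsingleton
    exact (homotopyGroupSuccEquiv (k + 1) t).subsingleton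

end HomotopyFibre

end ExactSequence

/-! ### Alternating products of orders of homotopy groups -/

section EulerFactor

/-- The alternating product `∏ |π_k(X, x)| ^ (-1) ^ k` over `1 ≤ k ≤ m`. -/
def loopFactor : ℕ → (X : Type u) → [TopologicalSpace X] → X → ℚ
  | 0, _, _, _ => 1
  | m + 1, X, _, x => (Nat.card (π_ 1 X x) * loopFactor m (LoopSpace X x) (Path.refl x))⁻¹

theorem loopFactor_congr (m : ℕ) : ∀ {X : Type u} {Y : Type v} [TopologicalSpace X]
    [TopologicalSpace Y] {x : X} {y : Y}
    (_ : ∀ k, Nat.card (π_ (k + 1) X x) = Nat.card (π_ (k + 1) Y y)),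
    loopFactor m X x = loopFactor m Y y := by
  induction m with
  | zero => intros; rfl
  | succ m ih =>
    intro X Y _ _ x y h
    rw [loopFactor, loopFactor, h 0]
    congr 2
    refine ih fun k => ?_
    rw [← Nat.card_congr (homotopyGroupSuccEquiv (k + 1) x),
      ← Nat.card_congr (homotopyGroupSuccEquiv (k + 1) y), h]

theorem loopFactor_congr_of_isHEquiv (m : ℕ) {X : Type u} {Y : Type v} [TopologicalSpace X]
    [TopologicalSpace Y] {f : C(X, Y)} (hf : IsHEquiv f) (x : X) :
    loopFactor m X x = loopFactor m Y (f x) :=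
  loopFactor_congr m fun k =>
    (nonempty_homotopyGroup_equiv_of_isHEquiv (k + 1) hf x).elim Nat.card_congr

theorem loopFactor_loopSpace (m : ℕ) {X : Type u} [TopologicalSpace X] {x : X}
    (p : LoopSpace X x) :
    loopFactor m (LoopSpace X x) p = loopFactor m (LoopSpace X x) (Path.refl x) :=
  loopFactor_congr m fun k =>
    (nonempty_homotopyGroup_loopSpace_equiv (k + 1) p).elim fun e => (Nat.card_congr e).symm

theorem loopFactor_pos (m : ℕ) : ∀ {X : Type u} [TopologicalSpace X] {x : X}
    (_ : ∀ k, Finite (π_ (k + 1) X x)), 0 < loopFactor m X x := by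
  induction m with
  | zero => intros; exact one_pos
  | succ m ih =>
    intro X _ x h
    have h1 := h 0
    have h2 : 0 < Nat.card (π_ (0 + 1) X x) := Nat.card_pos
    have h3 := ih (x := Path.refl x) fun k =>
      have := h (k + 1)
      Finite.of_equiv _ (homotopyGroupSuccEquiv (k + 1) x)
    rw [loopFactor]
    have : (0 : ℚ) < Nat.card (π_ 1 X x) := by exact_mod_cast h2
    positivity

theorem loopFactor_stable (n : ℕ) : ∀ {X : Type u} [TopologicalSpace X] {x : X} {m : ℕ}
    (_ : n ≤ m) (_ : ∀ k, n < k → Subsingleton (π_ k X x)),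
    loopFactor m X x = loopFactor n X x := by
  induction n with
  | zero =>
    intro X _ x m _ h
    induction m generalizing X with
    | zero => rfl
    | succ m ih =>
      have := h 1 one_pos
      change (_ * loopFactor m (LoopSpace X x) (Path.refl x))⁻¹ = (1 : ℚ)
      rw [Nat.card_unique, ih (Nat.zero_le m)]
      · simp [loopFactor]
      · intro k _
        have := h (k + 1) (Nat.succ_pos k)
        exact (homotopyGroupSuccEquiv k x).symm.subsingleton
  | succ n ih =>
    intro X _ x m hm h
    obtain ⟨m, rfl⟩ : ∃ m', m = m' + 1 := ⟨m - 1, by omega⟩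
    rw [loopFactor, loopFactor, ih (by omega)]
    intro k hk
    have := h (k + 1) (by omega)
    exact (homotopyGroupSuccEquiv k x).symm.subsingleton

/-- All components of a loop space have the same homotopy groups, so the sum is `|π₁|` times a
common term. -/
theorem homotopyCardinalityAux_loopSpace (m : ℕ) : ∀ {X : Type u} [TopologicalSpace X] {x : X}
    (_ : ∀ k, Finite (π_ (k + 1) X x)),
    homotopyCardinalityAux m (LoopSpace X x) = (loopFactor m X x)⁻¹ := by
  induction m with
  | zero => intros; simp [homotopyCardinalityAux, loopFactor]
  | succ m ih =>
    intro X _ x h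
    have h0 := h 0
    have : Finite (ZerothHomotopy (LoopSpace X x)) := Finite.of_equiv _ (homotopyGroupOneEquiv x)
    have : Fintype (ZerothHomotopy (LoopSpace X x)) := Fintype.ofFinite _
    have h1 : ∀ c : ZerothHomotopy (LoopSpace X x),
        1 / homotopyCardinalityAux m (LoopSpace (LoopSpace X x) c.out) =
          loopFactor m (LoopSpace X x) (Path.refl x) := by
      intro c
      rw [ih, one_div, inv_inv, loopFactor_loopSpace]
      intro k
      obtain ⟨e⟩ := nonempty_homotopyGroup_loopSpace_equiv (k + 1) c.out
      have := h (k + 1)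
      exact Finite.of_equiv _ ((homotopyGroupSuccEquiv (k + 1) x).trans e)
    rw [homotopyCardinalityAux, loopFactor, inv_inv, finsum_congr h1, finsum_eq_sum_of_fintype,
      Finset.sum_const, nsmul_eq_mul, Finset.card_univ, ← Nat.card_eq_fintype_card,
      Nat.card_congr (homotopyGroupOneEquiv x)]

/-- Any truncation bound may replace the least one, so `ΛE` and `E` can be treated with the same
`m`. -/
theorem homotopyCardinality_eq_finsum {X : Type u} [TopologicalSpace X] (hX : IsPiFinite X)
    {m : ℕ} (hm : IsTruncatedSpace m X) :
    homotopyCardinality X = ∑ᶠ c : ZerothHomotopy X, loopFactor m X c.out := by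
  have h1 : IsTruncatedSpace (sInf {n : ℕ | IsTruncatedSpace n X}) X :=
    Nat.sInf_mem (s := {n : ℕ | IsTruncatedSpace n X}) ⟨m, hm⟩
  have h2 : sInf {n : ℕ | IsTruncatedSpace n X} ≤ m := Nat.sInf_le hm
  rw [homotopyCardinality, homotopyCardinalityAux]
  refine finsum_congr fun c => ?_
  rw [homotopyCardinalityAux_loopSpace, one_div, inv_inv,
    loopFactor_stable _ h2 fun k hk => h1 k hk _]
  exact fun k => hX.finite_homotopyGroups _ (by omega) _

open HomotopyFibre in
/-- Multiplicativity of the alternating product in a homotopy fibre sequence. -/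
theorem loopFactor_eq_mul (m : ℕ) : ∀ {T : Type u} {B : Type u} [TopologicalSpace T]
    [TopologicalSpace B] (f : C(T, B)) (t : T)
    (_ : ∀ k, Finite (π_ (k + 1) (HomotopyFibre f (f t)) (base f t)))
    (_ : ∀ k, Finite (π_ (k + 1) B (f t))) (_ : Subsingleton (π_ (m + 1) B (f t))),
    loopFactor m T t = loopFactor m (HomotopyFibre f (f t)) (base f t) *
      loopFactor m B (f t) * Nat.card (ComponentsOver f (f t) (.mk t)) := by
  induction m with
  | zero =>
    -- The triviality of `π_{m+1}(B)` closes the truncated count: here `π₁ B` is trivial, so a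
    -- single component lies over that of `t`.
    intro T B _ _ f t _ _ h
    have h1 := card_fundamentalGroup_base f t
    rw [← card_homotopyGroup_one, Nat.card_unique] at h1
    rw [Nat.eq_one_of_mul_eq_one_right h1.symm]
    simp [loopFactor]
  | succ m ih =>
    intro T B _ _ f t hF hB h
    have hT := fun k => finite_homotopyGroup k f t (hF k) (hB k)
    have e := nonempty_homotopyGroup_succ_equiv f t
    have h1 := ih (pathMap f t t) (Path.refl t)
      (fun k => have := hF (k + 1); (e (k + 1)).elim fun e => Finite.of_equiv _ e.symm)
      (fun k => have := hB (k + 1); Finite.of_equiv _ (homotopyGroupSuccEquiv (k + 1) (f t)))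
      (homotopyGroupSuccEquiv (m + 1) (f t)).symm.subsingleton
    have h2 : loopFactor m (HomotopyFibre (pathMap f t t) (pathMap f t t (Path.refl t)))
        (base (pathMap f t t) (Path.refl t)) =
        loopFactor m (LoopSpace (HomotopyFibre f (f t)) (base f t)) (Path.refl _) :=
      (loopFactor_congr_of_isHEquiv m (IsHEquiv.of_homeomorph (loopHomeo f t)) (Path.refl _)).symm
    have h3 := card_homotopyGroup_one_mul f t
    have p1 : 0 < loopFactor (m + 1) (HomotopyFibre f (f t)) (base f t) := loopFactor_pos _ hF
    have p2 : 0 < loopFactor (m + 1) B (f t) := loopFactor_pos _ hB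
    have p3 : 0 < loopFactor (m + 1) T t := loopFactor_pos _ hT
    rw [h2] at h1
    rw [loopFactor] at p1 p2 p3 ⊢
    rw [loopFactor, loopFactor]
    change _ = _ * loopFactor m (LoopSpace B (f t)) (Path.refl (f t)) * _ at h1
    rw [h1] at p3 ⊢
    generalize loopFactor m (LoopSpace (HomotopyFibre f (f t)) (base f t)) (Path.refl _) = x at *
    generalize loopFactor m (LoopSpace B (f t)) (Path.refl (f t)) = y at *
    have h4 := congrArg (Nat.cast (R := ℚ)) h3
    push_cast at h4
    generalize (Nat.card (ComponentsOver (pathMap f t t) (pathMap f t t (Path.refl t))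
        (.mk (Path.refl t))) : ℚ) = o' at *
    generalize (Nat.card (ComponentsOver f (f t) (.mk t)) : ℚ) = o at *
    generalize (Nat.card (π_ 1 T t) : ℚ) = pT at *
    generalize (Nat.card (π_ 1 B (f t)) : ℚ) = pB at *
    generalize (Nat.card (π_ 1 (HomotopyFibre f (f t)) (base f t)) : ℚ) = pF at *
    have q1 : pF * x ≠ 0 := (inv_pos.1 p1).ne'
    have q2 : pB * y ≠ 0 := (inv_pos.1 p2).ne'
    have q3 : pT * (x * y * o') ≠ 0 := (inv_pos.1 p3).ne'
    -- Substituting the formula for `Ωf` leaves the claim `pF * pB = o' * pT * o`, up to the factor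
    -- `x * y`; this is `h4`.
    rw [← mul_inv, inv_mul_eq_div, inv_eq_one_div, div_eq_div_iff q3 (mul_ne_zero q1 q2)]
    linear_combination x * y * h4

end EulerFactor

/-! ### The homotopy fibre of evaluation on the free loop space -/

section FreeLoops

variable {E : Type u} [TopologicalSpace E]

namespace FreeLoopSpace

/-- The underlying data of a point of the free loop space. -/
def val : C(FreeLoopSpace E, E × E × C(I, E × E)) :=
  ⟨Subtype.val, continuous_subtype_val (p := fun t : E × E × C(I, E × E) =>
    t.2.2 0 = diagonalMap E t.1 ∧ t.2.2 1 = diagonalMap E t.2.1)⟩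

/-- Continuity of maps into the free loop space. -/
theorem continuous_mk {A : Type*} [TopologicalSpace A] {g : A → E × E × C(I, E × E)}
    (hg : Continuous g) (h : ∀ a, (g a).2.2 0 = diagonalMap E (g a).1 ∧
      (g a).2.2 1 = diagonalMap E (g a).2.1) :
    Continuous fun a => (⟨g a, h a⟩ : FreeLoopSpace E) :=
  Continuous.subtype_mk (p := fun t : E × E × C(I, E × E) =>
    t.2.2 0 = diagonalMap E t.1 ∧ t.2.2 1 = diagonalMap E t.2.1) hg h

variable (E) in
/-- The first projection of the free loop space. -/
def fst : C(FreeLoopSpace E, E) := ⟨fun l => (val l).1, by fun_prop⟩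

variable {x : E}

/-- The first path, the second path and the path to the base point, of a point of the homotopy
fibre of the first projection. -/
def segments : C(HomotopyFibre (fst E) x, C(I, E × E) × C(I, E)) :=
  ⟨fun h => ((val h.1.1).2.2, h.1.2), by fun_prop⟩

theorem segments_zero (h : HomotopyFibre (fst E) x) :
    (segments h).1 0 = ((val h.1.1).1, (val h.1.1).1) := h.1.1.2.1

theorem segments_one (h : HomotopyFibre (fst E) x) :
    (segments h).1 1 = ((val h.1.1).2.1, (val h.1.1).2.1) := h.1.1.2.2

theorem segments_snd_zero (h : HomotopyFibre (fst E) x) :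
    (segments h).2 0 = (val h.1.1).1 := h.2.1

theorem segments_snd_one (h : HomotopyFibre (fst E) x) : (segments h).2 1 = x := h.2.2

/-- Projection of the real line to the unit interval. -/
abbrev clamp (r : ℝ) : I := Set.projIcc 0 1 zero_le_one r

theorem clamp_zero : clamp 0 = 0 := Set.projIcc_left _
theorem clamp_one : clamp 1 = 1 := Set.projIcc_right _

/-- The loop, parametrized by `[0, 4]`, which runs from `x` along the reverse of the path to the
base point, the first path, the reverse of the second path, and the path to the base point. -/
def bigLoop (x : E) : C(HomotopyFibre (fst E) x × ℝ, E) where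
  toFun q :=
    if q.2 ≤ 1 then (segments q.1).2 (clamp (1 - q.2))
    else if q.2 ≤ 2 then ((segments q.1).1 (clamp (q.2 - 1))).1
    else if q.2 ≤ 3 then ((segments q.1).1 (clamp (3 - q.2))).2
    else (segments q.1).2 (clamp (q.2 - 3))
  continuous_toFun := by
    have hc : Continuous clamp := continuous_projIcc
    refine Continuous.if_le (by fun_prop) ?_ (by fun_prop) (by fun_prop) ?_
    · refine Continuous.if_le (by fun_prop) ?_ (by fun_prop) (by fun_prop) ?_
      · refine Continuous.if_le (by fun_prop) (by fun_prop) (by fun_prop) (by fun_prop) ?_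
        intro q hq
        rw [hq, sub_self, clamp_zero, segments_zero, segments_snd_zero]
      · intro q hq
        rw [hq, if_pos (by norm_num), show (2 : ℝ) - 1 = 1 by norm_num,
          show (3 : ℝ) - 2 = 1 by norm_num, clamp_one, segments_one]
    · intro q hq
      rw [hq, if_pos (by norm_num), sub_self, clamp_zero, segments_zero, segments_snd_zero]

theorem bigLoop_apply (h : HomotopyFibre (fst E) x) (r : ℝ) : bigLoop x (h, r) =
    if r ≤ 1 then (segments h).2 (clamp (1 - r))
    else if r ≤ 2 then ((segments h).1 (clamp (r - 1))).1
    else if r ≤ 3 then ((segments h).1 (clamp (3 - r))).2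
    else (segments h).2 (clamp (r - 3)) := rfl

theorem bigLoop_one_sub (h : HomotopyFibre (fst E) x) (t : I) :
    bigLoop x (h, 1 - t) = (segments h).2 t := by
  rw [bigLoop_apply, if_pos (by linarith [t.2.1]), sub_sub_cancel, clamp, Set.projIcc_val]

theorem bigLoop_three_add (h : HomotopyFibre (fst E) x) (t : I) :
    bigLoop x (h, 3 + t) = (segments h).2 t := by
  have h0 := t.2.1
  rw [bigLoop_apply, if_neg (by linarith), if_neg (by linarith)]
  split_ifs with h3
  · have ht : t = 0 := Subtype.ext (by change (t : ℝ) = 0; linarith)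
    subst ht
    simp [segments_zero, segments_snd_zero]
  · rw [add_sub_cancel_left, clamp, Set.projIcc_val]

theorem bigLoop_one_add (h : HomotopyFibre (fst E) x) (t : I) :
    bigLoop x (h, 1 + t) = ((segments h).1 t).1 := by
  have h0 := t.2.1
  have h1 := t.2.2
  rw [bigLoop_apply]
  split_ifs with h3 h4
  · have ht : t = 0 := Subtype.ext (by change (t : ℝ) = 0; linarith)
    subst ht
    simp [segments_zero, segments_snd_zero]
  · rw [add_sub_cancel_left, clamp, Set.projIcc_val]
  all_goals linarith

theorem bigLoop_three_sub (h : HomotopyFibre (fst E) x) (t : I) :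
    bigLoop x (h, 3 - t) = ((segments h).1 t).2 := by
  have h0 := t.2.1
  have h1 := t.2.2
  rw [bigLoop_apply, if_neg (by linarith)]
  split_ifs with h3 h4
  · have ht : t = 1 := Subtype.ext (by change (t : ℝ) = 1; linarith)
    subst ht
    norm_num [clamp_one, segments_one]
  · rw [sub_sub_cancel, clamp, Set.projIcc_val]
  · linarith

theorem bigLoop_zero (h : HomotopyFibre (fst E) x) : bigLoop x (h, 0) = x := by
  have := bigLoop_one_sub h 1
  rwa [segments_snd_one, Set.Icc.coe_one, sub_self] at this

theorem bigLoop_four (h : HomotopyFibre (fst E) x) : bigLoop x (h, 4) = x := by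
  have := bigLoop_three_add h 1
  rw [segments_snd_one, Set.Icc.coe_one] at this
  norm_num at this
  exact this

/-- The loop associated with a point of the homotopy fibre of the first projection. -/
def toLoop (x : E) : C(HomotopyFibre (fst E) x, LoopSpace E x) where
  toFun h := ⟨⟨fun t => bigLoop x (h, 4 * t), by fun_prop⟩, by simp [bigLoop_zero],
    by simp [bigLoop_four]⟩
  continuous_toFun := Path.continuous_uncurry_iff.1 (by
    change Continuous fun q : HomotopyFibre (fst E) x × I => bigLoop x (q.1, 4 * q.2)
    fun_prop)

/-- The point of the homotopy fibre of the first projection given by a loop. -/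
def ofLoop (x : E) : C(LoopSpace E x, HomotopyFibre (fst E) x) where
  toFun p := ⟨(⟨(x, x, ⟨fun t => (p t, x), by fun_prop⟩), by simp [diagonalMap], by
    simp [diagonalMap]⟩, ContinuousMap.const _ x), rfl, rfl⟩
  continuous_toFun := by
    refine Continuous.subtype_mk (Continuous.prodMk (continuous_mk ?_ _) continuous_const) _
    refine continuous_const.prodMk (continuous_const.prodMk ?_)
    refine ContinuousMap.continuous_of_continuous_uncurry _ ?_
    change Continuous fun q : LoopSpace E x × I => (q.1 q.2, x)
    fun_prop

theorem toLoop_comp_ofLoop (x : E) :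
    ((toLoop x).comp (ofLoop x)).Homotopic (ContinuousMap.id _) := by
  -- For `ofLoop x p` the big loop is constant outside `[1, 2]`, so the composite is `p`
  -- reparametrized by `clamp (4 * t - 1)`.
  refine homotopic_of_pathFamily (C := I) ⟨fun q : LoopSpace E x × I => q.1 q.2, by fun_prop⟩
    (c₀ := 0) (c₁ := 1) ⟨⟨fun t => clamp (4 * t - 1), continuous_projIcc.comp (by fun_prop)⟩,
      Set.projIcc_of_le_left zero_le_one (by simp),
      Set.projIcc_of_right_le zero_le_one (by norm_num)⟩ Path.id ?_ ?_
  · intro p t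
    change bigLoop x (ofLoop x p, 4 * t) = p (clamp (4 * t - 1))
    rw [bigLoop_apply]
    split_ifs with h1 h2 h3
    · rw [show clamp (4 * (t : ℝ) - 1) = 0 from Set.projIcc_of_le_left _ (by linarith)]
      exact p.source.symm
    · rfl
    · rw [show clamp (4 * (t : ℝ) - 1) = 1 from Set.projIcc_of_right_le _ (by linarith)]
      exact p.target.symm
    · rw [show clamp (4 * (t : ℝ) - 1) = 1 from Set.projIcc_of_right_le _ (by linarith)]
      exact p.target.symm
  · intro p t
    rfl

/-- The contraction of the path to the base point and of the second path. -/
def contraction (x : E) : C(I × HomotopyFibre (fst E) x, HomotopyFibre (fst E) x) where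
  -- All pieces are arcs of the big loop. At time `s` the first path covers `[1 - s, 2 + 2s]`, the
  -- second runs from `3 + s` back to `2 + 2s`, and the path to `x` covers `[3 + s, 4]`. The ends
  -- match because the parameters `1 - s` and `3 + s` give the same point.
  toFun q := ⟨(⟨(bigLoop x (q.2, 3 + q.1), bigLoop x (q.2, 2 + 2 * q.1),
      ⟨fun t => (bigLoop x (q.2, 1 - q.1 + t * (1 + 3 * q.1)),
        bigLoop x (q.2, 3 + q.1 + t * (q.1 - 1))), by fun_prop⟩), by
        simp [diagonalMap, bigLoop_one_sub, bigLoop_three_add], by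
        simp only [diagonalMap, ContinuousMap.coe_mk, Set.Icc.coe_one, ContinuousMap.prod_eval,
          ContinuousMap.id_apply]
        ring_nf⟩,
      ⟨fun t => bigLoop x (q.2, 3 + q.1 + t * (1 - q.1)), by fun_prop⟩), by
        simp only [ContinuousMap.coe_mk, Set.Icc.coe_zero, zero_mul, add_zero]
        rfl, by
        have : (3 : ℝ) + q.1 + 1 * (1 - q.1) = 4 := by ring
        simp only [ContinuousMap.coe_mk, Set.Icc.coe_one, this, bigLoop_four]⟩
  continuous_toFun := by
    refine Continuous.subtype_mk (Continuous.prodMk (continuous_mk ?_ _) ?_) _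
    · refine Continuous.prodMk (by fun_prop) (Continuous.prodMk (by fun_prop) ?_)
      refine ContinuousMap.continuous_of_continuous_uncurry _ ?_
      change Continuous fun r : (I × HomotopyFibre (fst E) x) × I =>
        (bigLoop x (r.1.2, 1 - r.1.1 + r.2 * (1 + 3 * r.1.1)),
          bigLoop x (r.1.2, 3 + r.1.1 + r.2 * (r.1.1 - 1)))
      fun_prop
    · refine ContinuousMap.continuous_of_continuous_uncurry _ ?_
      change Continuous fun r : (I × HomotopyFibre (fst E) x) × I =>
        bigLoop x (r.1.2, 3 + r.1.1 + r.2 * (1 - r.1.1))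
      fun_prop

theorem ofLoop_comp_toLoop (x : E) :
    ((ofLoop x).comp (toLoop x)).Homotopic (ContinuousMap.id _) := by
  refine ContinuousMap.Homotopic.symm ⟨⟨contraction x, fun h => ?_, fun h => ?_⟩⟩
  · refine Subtype.ext (Prod.ext (Subtype.ext (Prod.ext ?_ (Prod.ext ?_ ?_))) ?_)
    · change bigLoop x (h, 3 + (0 : I)) = _
      rw [bigLoop_three_add, segments_snd_zero]; rfl
    · change bigLoop x (h, 2 + 2 * ((0 : I) : ℝ)) = _
      have : (2 : ℝ) + 2 * ((0 : I) : ℝ) = 1 + (1 : I) := by norm_num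
      rw [this, bigLoop_one_add, segments_one]; rfl
    · ext t
      · change bigLoop x (h, 1 - ((0 : I) : ℝ) + t * (1 + 3 * ((0 : I) : ℝ))) = _
        have : 1 - ((0 : I) : ℝ) + t * (1 + 3 * ((0 : I) : ℝ)) = 1 + t := by simp
        rw [this, bigLoop_one_add]; rfl
      · change bigLoop x (h, 3 + ((0 : I) : ℝ) + t * (((0 : I) : ℝ) - 1)) = _
        have : 3 + ((0 : I) : ℝ) + t * (((0 : I) : ℝ) - 1) = 3 - t := by simp; ring
        rw [this, bigLoop_three_sub]; rfl
    · ext t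
      change bigLoop x (h, 3 + ((0 : I) : ℝ) + t * (1 - ((0 : I) : ℝ))) = _
      have : 3 + ((0 : I) : ℝ) + t * (1 - ((0 : I) : ℝ)) = 3 + t := by simp
      rw [this, bigLoop_three_add]; rfl
  · refine Subtype.ext (Prod.ext (Subtype.ext (Prod.ext ?_ (Prod.ext ?_ ?_))) ?_)
    · change bigLoop x (h, 3 + (1 : I)) = x
      rw [bigLoop_three_add, segments_snd_one]
    · change bigLoop x (h, 2 + 2 * ((1 : I) : ℝ)) = x
      have : (2 : ℝ) + 2 * ((1 : I) : ℝ) = 4 := by norm_num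
      rw [this, bigLoop_four]
    · ext t
      · change bigLoop x (h, 1 - ((1 : I) : ℝ) + t * (1 + 3 * ((1 : I) : ℝ))) =
          bigLoop x (h, 4 * t)
        congr 2
        simp; ring
      · change bigLoop x (h, 3 + ((1 : I) : ℝ) + t * (((1 : I) : ℝ) - 1)) = x
        have : 3 + ((1 : I) : ℝ) + t * (((1 : I) : ℝ) - 1) = 4 := by norm_num
        rw [this, bigLoop_four]
    · ext t
      change bigLoop x (h, 3 + ((1 : I) : ℝ) + t * (1 - ((1 : I) : ℝ))) = x
      have : 3 + ((1 : I) : ℝ) + t * (1 - ((1 : I) : ℝ)) = 4 := by norm_num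
      rw [this, bigLoop_four]

/-- The homotopy fibre of the first projection of the free loop space is the loop space. -/
theorem isHEquiv_toLoop (x : E) : IsHEquiv (toLoop x) :=
  ⟨ofLoop x, ofLoop_comp_toLoop x, toLoop_comp_ofLoop x⟩

end FreeLoopSpace

end FreeLoops

/-! ### Finiteness and cardinality of the free loop space -/

section FreeLoopCardinality

variable {E : Type u} [TopologicalSpace E]

/-- The loop spaces of a `π`-finite space are `π`-finite. -/
theorem IsPiFinite.loopSpace (hE : IsPiFinite E) (x : E) : IsPiFinite (LoopSpace E x) := by
  have key : ∀ (k : ℕ) (p : LoopSpace E x), Nonempty (π_ (k + 1) E x ≃ π_ k (LoopSpace E x) p) :=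
    fun k p => (nonempty_homotopyGroup_loopSpace_equiv k p).map (homotopyGroupSuccEquiv k x).trans
  refine ⟨?_, ?_, ?_⟩
  · obtain ⟨n, hn⟩ := hE.truncated
    refine ⟨n, fun k hk p => ?_⟩
    obtain ⟨e⟩ := key k p
    have := hn (k + 1) (by omega) x
    exact e.symm.subsingleton
  · have := hE.finite_homotopyGroups 1 le_rfl x
    exact Finite.of_equiv _ (homotopyGroupOneEquiv x)
  · intro k _ p
    obtain ⟨e⟩ := key k p
    have := hE.finite_homotopyGroups (k + 1) (by omega) x
    exact Finite.of_equiv _ e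

namespace FreeLoopSpace

open HomotopyFibre

theorem nonempty_homotopyGroup_fibre_equiv (k : ℕ) {x : E} (e : HomotopyFibre (fst E) x) :
    Nonempty (π_ k (HomotopyFibre (fst E) x) e ≃ π_ (k + 1) E x) := by
  obtain ⟨e₁⟩ := nonempty_homotopyGroup_equiv_of_isHEquiv k (isHEquiv_toLoop x) e
  obtain ⟨e₂⟩ := nonempty_homotopyGroup_loopSpace_equiv k (toLoop x e)
  exact ⟨e₁.trans (e₂.symm.trans (homotopyGroupSuccEquiv k x).symm)⟩

/-- The path components of the homotopy fibre of the first projection. -/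
def zerothHomotopyFibreEquiv (x : E) :
    ZerothHomotopy (HomotopyFibre (fst E) x) ≃ π_ 1 E x :=
  (Equiv.ofBijective _ (ZerothHomotopy.map_bijective (isHEquiv_toLoop x))).trans
    (homotopyGroupOneEquiv x).symm

theorem finite_homotopyGroup_fibre (hE : IsPiFinite E) (k : ℕ) {x : E}
    (e : HomotopyFibre (fst E) x) : Finite (π_ k (HomotopyFibre (fst E) x) e) := by
  obtain ⟨e'⟩ := nonempty_homotopyGroup_fibre_equiv k e
  have := hE.finite_homotopyGroups (k + 1) (by omega) x
  exact Finite.of_equiv _ e'.symm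

/-- Here `π_k(ΛE)` sits between `π_{k+1}(E)`, from the fibre, and `π_k(E)`. -/
theorem isTruncatedSpace {n : ℕ} (hn : IsTruncatedSpace n E) :
    IsTruncatedSpace n (FreeLoopSpace E) := by
  intro k hk l
  obtain ⟨k, rfl⟩ : ∃ k', k = k' + 1 := ⟨k - 1, by omega⟩
  obtain ⟨e⟩ := nonempty_homotopyGroup_fibre_equiv (k + 1) (base (fst E) l)
  have := hn (k + 1 + 1) (by omega) (fst E l)
  exact subsingleton_homotopyGroup k (fst E) l e.subsingleton (hn (k + 1) hk _)

/-- The components of the homotopy fibres, one for each component of the base, map onto the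
components of the free loop space. -/
theorem surjective_map_proj :
    Function.Surjective fun c : Σ d : ZerothHomotopy E,
      ZerothHomotopy (HomotopyFibre (fst E) d.out) => ZerothHomotopy.map (proj (fst E) _) c.2 := by
  intro c
  obtain ⟨e, he⟩ := exists_map_proj_eq (f := fst E) (d := c)
    (ZerothHomotopy.mk_out (ZerothHomotopy.map (fst E) c)).symm
  exact ⟨⟨_, e⟩, he⟩

theorem finite_zerothHomotopy_fibre (hE : IsPiFinite E) (x : E) :
    Finite (ZerothHomotopy (HomotopyFibre (fst E) x)) :=
  have := hE.finite_homotopyGroups 1 le_rfl x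
  Finite.of_equiv _ (zerothHomotopyFibreEquiv x).symm

/-- The free loop space of a `π`-finite space is `π`-finite. -/
theorem isPiFinite (hE : IsPiFinite E) : IsPiFinite (FreeLoopSpace E) := by
  refine ⟨hE.truncated.imp fun n hn => isTruncatedSpace hn, ?_, ?_⟩
  · have := hE.finite_components
    have (d : ZerothHomotopy E) := finite_zerothHomotopy_fibre hE d.out
    exact Finite.of_surjective _ surjective_map_proj
  · intro k hk l
    obtain ⟨k, rfl⟩ : ∃ k', k = k' + 1 := ⟨k - 1, by omega⟩
    exact finite_homotopyGroup k (fst E) l (finite_homotopyGroup_fibre hE _ _)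
      (hE.finite_homotopyGroups _ hk _)

theorem loopFactor_fibre (m : ℕ) {x : E} (e : HomotopyFibre (fst E) x) :
    loopFactor m (HomotopyFibre (fst E) x) e = loopFactor m (LoopSpace E x) (Path.refl x) :=
  (loopFactor_congr_of_isHEquiv m (isHEquiv_toLoop x) e).trans (loopFactor_loopSpace m _)

/-- The key cancellation: by definition, the product for `Ω_x E` up to `m` times that for `E` up to
`m + 1` is `1 / |π₁(E, x)|`. Truncation allows the extra degree. -/
theorem loopFactor_eq_div (hE : IsPiFinite E) {m : ℕ} (hm : IsTruncatedSpace m E)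
    (l : FreeLoopSpace E) :
    loopFactor m (FreeLoopSpace E) l =
      (Nat.card (ComponentsOver (fst E) (fst E l) (.mk l)) : ℚ) / Nat.card (π_ 1 E (fst E l)) := by
  have hfin : ∀ k, Finite (π_ (k + 1) E (fst E l)) := fun k =>
    hE.finite_homotopyGroups _ (by omega) _
  have h1 : loopFactor (m + 1) E (fst E l) = loopFactor m E (fst E l) :=
    loopFactor_stable m (Nat.le_succ m) fun k hk => hm k hk _
  have h2 : 0 < loopFactor (m + 1) E (fst E l) := loopFactor_pos _ hfin
  rw [loopFactor_eq_mul m (fst E) l (fun k => finite_homotopyGroup_fibre hE _ _) hfin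
    (hm _ (Nat.lt_succ_self m) _), loopFactor_fibre, ← h1]
  rw [loopFactor] at h2 ⊢
  have h3 := (inv_pos.1 h2).ne'
  have h4 := left_ne_zero_of_mul h3
  have h5 := right_ne_zero_of_mul h3
  field_simp

theorem homotopyCardinality_eq_card (hE : IsPiFinite E) :
    homotopyCardinality (FreeLoopSpace E) = (Nat.card (ZerothHomotopy E) : ℚ) := by
  classical
  obtain ⟨m, hm⟩ := hE.truncated
  have := hE.finite_components
  have := (isPiFinite hE).finite_components
  have := finite_zerothHomotopy_fibre hE
  have := Fintype.ofFinite (ZerothHomotopy E)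
  have := Fintype.ofFinite (ZerothHomotopy (FreeLoopSpace E))
  have := fun x : E => Fintype.ofFinite (ZerothHomotopy (HomotopyFibre (fst E) x))
  have h1 : ∀ (d : ZerothHomotopy E) (c : ZerothHomotopy (FreeLoopSpace E)),
      ZerothHomotopy.map (fst E) c = d → loopFactor m (FreeLoopSpace E) c.out =
        ((Finset.univ.filter fun e : ZerothHomotopy (HomotopyFibre (fst E) d.out) =>
          ZerothHomotopy.map (proj (fst E) d.out) e = c).card : ℚ) / Nat.card (π_ 1 E d.out) := by
    intro d c hc
    -- The representative of `c` lies over a point that is only joined to `d.out`, so `π₁` and the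
    -- fibre components are carried along a path.
    have hd : ZerothHomotopy.mk (fst E c.out) = ZerothHomotopy.mk d.out := by
      rw [ZerothHomotopy.mk_out, ← hc]
      exact congrArg (ZerothHomotopy.map (fst E)) (ZerothHomotopy.mk_out c)
    have hj := ZerothHomotopy.mk_eq_mk.1 hd
    obtain ⟨e⟩ := nonempty_homotopyGroup_equiv_of_joined 1 hj
    obtain ⟨δ⟩ := hj
    rw [loopFactor_eq_div hE hm, Nat.card_congr e, ZerothHomotopy.mk_out,
      Nat.card_congr (componentsOverEquiv δ c), Nat.card_eq_fintype_card, Fintype.card_subtype]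
  -- The numerators partition the components of the fibre over `d.out`, and there are `|π₁(E,
  -- d.out)|` of these.
  have h2 : ∀ d : ZerothHomotopy E,
      ∑ c with ZerothHomotopy.map (fst E) c = d, loopFactor m (FreeLoopSpace E) c.out = 1 := by
    intro d
    have := hE.finite_homotopyGroups 1 le_rfl d.out
    have h3 : (Nat.card (π_ 1 E d.out) : ℚ) ≠ 0 := by exact_mod_cast Nat.card_pos.ne'
    rw [Finset.sum_congr rfl fun c hc => h1 d c (Finset.mem_filter.1 hc).2, ← Finset.sum_div,
      ← Nat.cast_sum, div_eq_one_iff_eq h3, ← Nat.card_congr (zerothHomotopyFibreEquiv d.out),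
      Nat.card_eq_fintype_card, ← Finset.card_univ]
    refine congrArg Nat.cast (Finset.card_eq_sum_card_fiberwise fun e _ => ?_).symm
    simp only [Finset.coe_filter, Finset.mem_univ, true_and, Set.mem_ofPred_eq]
    exact (map_map_proj e).trans (ZerothHomotopy.mk_out d)
  rw [homotopyCardinality_eq_finsum (isPiFinite hE) (isTruncatedSpace hm),
    finsum_eq_sum_of_fintype, ← Finset.sum_fiberwise (g := ZerothHomotopy.map (fst E)),
    Finset.sum_congr rfl fun d _ => h2 d, Nat.card_eq_fintype_card]
  simp

end FreeLoopSpace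

/-- Needed so that each quotient in the middle sum is `1`, not the default value `0 / 0 = 0`. -/
theorem IsPiFinite.homotopyCardinality_pos {X : Type u} [TopologicalSpace X] [Nonempty X]
    (hX : IsPiFinite X) : 0 < homotopyCardinality X := by
  obtain ⟨m, hm⟩ := hX.truncated
  have := hX.finite_components
  have := Fintype.ofFinite (ZerothHomotopy X)
  rw [homotopyCardinality_eq_finsum hX hm, finsum_eq_sum_of_fintype]
  exact Finset.sum_pos (fun c _ => loopFactor_pos m fun k =>
    hX.finite_homotopyGroups (k + 1) (by omega) _) Finset.univ_nonempty

end FreeLoopCardinality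

end

theorem mainTheorem2 {E : Type*} [TopologicalSpace E] (hE : IsPiFinite E) :
    IsPiFinite (FreeLoopSpace E) ∧
    (∀ x : E, IsPiFinite (LoopSpace E x)) ∧
    homotopyCardinality (FreeLoopSpace E) =
      ∑ᶠ c : ZerothHomotopy E,
        homotopyCardinality (LoopSpace E c.out) / homotopyCardinality (LoopSpace E c.out) ∧
    homotopyCardinality (FreeLoopSpace E) = (Nat.card (ZerothHomotopy E) : ℚ) := by
  have h := FreeLoopSpace.homotopyCardinality_eq_card hE
  refine ⟨FreeLoopSpace.isPiFinite hE, hE.loopSpace, ?_, h⟩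
  have := hE.finite_components
  have := Fintype.ofFinite (ZerothHomotopy E)
  refine h.trans (Eq.symm ((finsum_congr fun c : ZerothHomotopy E =>
    div_self (hE.loopSpace c.out).homotopyCardinality_pos.ne').trans ?_))
  rw [finsum_eq_sum_of_fintype, Nat.card_eq_fintype_card]
  simp
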